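/- Let $\mathcal H$ be a complex Hilbert space and let $\mathcal R\subseteq\mathcal L(\mathcal H)$ be a von Neumann algebra whose unit is the identity operator $I$. Let $\mathcal P(\mathcal R)$ be the complete lattice of orthogonal projections in $\mathcal R$. A dual ideal of $\mathcal P(\mathcal R)$ is a nonempty subset that does not contain $0$, is closed under binary meets and is upward closed. The Stone spectrum $\mathcal Q(\mathcal R)$ is the set of maximal dual ideals of $\mathcal P(\mathcal R)$. For a selfadjoint $A\in\mathcal R$ with (right-continuous) spectral family $E^A=(E^A_\lambda)_{\lambda\in\mathbb R}$ in $\mathcal P(\mathcal R)$, so that $A=\int\lambda\,dE^A_\lambda$, define for $\mathfrak B\in\mathcal Q(\mathcal R)$ \[ f_A(\mathfrak B):=\inf\{\lambda\in\mathbb R\mid E^A_\lambda\in\mathfrak B\},\qquad g_A(\mathfrak B):=\sup\{\lambda\in\mathbb R\mid I-E^A_\lambda\in\mathfrak B\}. \] Let $\mathcal O(\mathcal R):=\{f_A\mid A\in\mathcal R,\ A=A^*\}$ be the set of observable functions $\mathcal Q(\mathcal R)\to\mathbb R$, and put $-\mathcal O(\mathcal R):=\{-f\mid f\in\mathcal O(\mathcal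 R)\}$. Then $\mathcal R$ is abelian if and only if $\mathcal O(\mathcal R)=-\mathcal O(\mathcal R)$. Moreover, for every $\mathcal R$, the set $-\mathcal O(\mathcal R)$ is exactly the set $\{g_A\mid A\in\mathcal R,\ A=A^*\}$ of mirrored observable functions. Thus $\mathcal R$ is abelian if and only if the observable functions and the mirrored observable functions form the same set. -/

import Mathlib

open MeasureTheory
open scoped Pointwise

/-! ### Stone spectrum of a lattice and spectral families -/

/-- A dual ideal of a bounded lattice: a nonempty subset that does not contain `⊥`, is closed
under binary meets and is closed upwards. -/
structure IsDualIdeal {L : Type*} [Lattice L] [BoundedOrder L] (J : Set L) : Prop where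
  nonempty : J.Nonempty
  bot_notMem : ⊥ ∉ J
  inf_mem : ∀ a ∈ J, ∀ b ∈ J, a ⊓ b ∈ J
  mem_of_le : ∀ a ∈ J, ∀ b, a ≤ b → b ∈ J

/-- The Stone spectrum of a bounded lattice: the set of its quasipoints, i.e. of its maximal
dual ideals. -/
@[ext]
structure StoneSpectrum (L : Type*) [Lattice L] [BoundedOrder L] where
  carrier : Set L
  maximal : Maximal IsDualIdeal carrier

/-- A (right-continuous) spectral family in a complete lattice. -/
structure IsSpectralFamily {L : Type*} [CompleteLattice L] (E : ℝ → L) : Prop where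
  mono : ∀ s t : ℝ, s ≤ t → E s ≤ E t
  right_cont : ∀ s : ℝ, E s = ⨅ t : Set.Ioi s, E t
  iInf_eq_bot : ⨅ s : ℝ, E s = ⊥
  iSup_eq_top : ⨆ s : ℝ, E s = ⊤

/-- A bounded spectral family in a complete lattice. -/
structure IsBoundedSpectralFamily {L : Type*} [CompleteLattice L] (E : ℝ → L) : Prop
    extends IsSpectralFamily E where
  bddBelow : ∃ a : ℝ, E a = ⊥
  bddAbove : ∃ b : ℝ, E b = ⊤

/-- The function `f_E(𝔅) = inf {s | E s ∈ 𝔅}` on the Stone spectrum. For a bounded spectral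
family the set is nonempty and bounded below, so that this is a genuine infimum. -/
noncomputable def observableFunctionOfFamily {L : Type*} [CompleteLattice L] (E : ℝ → L) :
    StoneSpectrum L → ℝ :=
  fun B => sInf {s : ℝ | E s ∈ B.carrier}

namespace VonNeumannAlgebra

/-! ### The projection lattice of a von Neumann algebra -/

/-- The set `P(R)` of (orthogonal) projections in the von Neumann algebra `R`. -/
@[ext]
structure Projection {H : Type*} [NormedAddCommGroup H] [InnerProductSpace ℂ H]
    [CompleteSpace H] (R : VonNeumannAlgebra H) where
  val : H →L[ℂ] H
  mem : val ∈ R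
  isStarProjection : IsStarProjection val

/-- Projections carry the usual operator order. -/
noncomputable instance Projection.instPartialOrder {H : Type*} [NormedAddCommGroup H] [InnerProductSpace ℂ H]
    [CompleteSpace H] (R : VonNeumannAlgebra H) : PartialOrder (Projection R) :=
  PartialOrder.lift Projection.val fun _ _ h => Projection.ext h

theorem Projection.le_iff_range_le {H : Type*} [NormedAddCommGroup H] [InnerProductSpace ℂ H]
    [CompleteSpace H] {R : VonNeumannAlgebra H} (p q : Projection R) :
    p ≤ q ↔ p.val.range ≤ q.val.range := by
  obtain ⟨hp, hp'⟩ := isStarProjection_iff_eq_starProjection_range.mp p.isStarProjection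
  obtain ⟨hq, hq'⟩ := isStarProjection_iff_eq_starProjection_range.mp q.isStarProjection
  rw [← Submodule.starProjection_le_starProjection_iff, ← hp', ← hq']
  rfl

theorem Projection.isClosed_range {H : Type*} [NormedAddCommGroup H] [InnerProductSpace ℂ H]
    [CompleteSpace H] {R : VonNeumannAlgebra H} (p : Projection R) :
    IsClosed (p.val.range : Set H) :=
  ContinuousLinearMap.IsIdempotentElem.isClosed_range p.isStarProjection.isIdempotentElem

theorem Projection.hasOrthogonalProjection_iInf {H : Type*} [NormedAddCommGroup H]
    [InnerProductSpace ℂ H] [CompleteSpace H] {R : VonNeumannAlgebra H} (S : Set (Projection R)) :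
    (⨅ p ∈ S, p.val.range : Submodule ℂ H).HasOrthogonalProjection := by
  have hcl : IsClosed ((⨅ p ∈ S, p.val.range : Submodule ℂ H) : Set H) := by
    simp only [Submodule.coe_iInf]
    exact isClosed_iInter fun p => isClosed_iInter fun _ => Projection.isClosed_range p
  have : CompleteSpace (⨅ p ∈ S, p.val.range : Submodule ℂ H) := hcl.completeSpace_coe
  infer_instance

attribute [local instance] Projection.hasOrthogonalProjection_iInf

theorem Projection.starProjection_iInf_mem {H : Type*} [NormedAddCommGroup H]
    [InnerProductSpace ℂ H] [CompleteSpace H] {R : VonNeumannAlgebra H} (S : Set (Projection R)) :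
    (⨅ p ∈ S, p.val.range : Submodule ℂ H).starProjection ∈ R := by
  rw [VonNeumannAlgebra.IsStarProjection.mem_iff isStarProjection_starProjection]
  intro y hy
  rw [Submodule.range_starProjection, Module.End.mem_invtSubmodule]
  intro x hx
  simp only [Submodule.mem_iInf, Submodule.mem_comap] at hx ⊢
  intro p hp
  exact (VonNeumannAlgebra.IsStarProjection.mem_iff p.isStarProjection R).mp p.mem y hy (hx p hp)

/-- The meet of a set of projections in `R`: the orthogonal projection onto the intersection of
the ranges. -/
noncomputable instance Projection.instInfSet {H : Type*} [NormedAddCommGroup H]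
    [InnerProductSpace ℂ H] [CompleteSpace H] (R : VonNeumannAlgebra H) :
    InfSet (Projection R) where
  sInf S := ⟨(⨅ p ∈ S, p.val.range : Submodule ℂ H).starProjection,
    Projection.starProjection_iInf_mem S, isStarProjection_starProjection⟩

theorem Projection.range_sInf {H : Type*} [NormedAddCommGroup H] [InnerProductSpace ℂ H]
    [CompleteSpace H] {R : VonNeumannAlgebra H} (S : Set (Projection R)) :
    (sInf S).val.range = ⨅ p ∈ S, p.val.range :=
  Submodule.range_starProjection _

/-- The complete lattice `P(R)` of projections in `R`. -/
noncomputable instance Projection.instCompleteLattice {H : Type*} [NormedAddCommGroup H]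
    [InnerProductSpace ℂ H] [CompleteSpace H] (R : VonNeumannAlgebra H) :
    CompleteLattice (Projection R) :=
  completeLatticeOfInf (Projection R) fun S => by
    refine ⟨fun p hp => ?_, fun q hq => ?_⟩
    · rw [Projection.le_iff_range_le, Projection.range_sInf]
      exact iInf₂_le p hp
    · rw [Projection.le_iff_range_le, Projection.range_sInf]
      exact le_iInf₂ fun p hp => (Projection.le_iff_range_le q p).mp (hq hp)

/-- The orthocomplement `I - p` of a projection `p` in `R`. -/
def Projection.compl {H : Type*} [NormedAddCommGroup H] [InnerProductSpace ℂ H]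
    [CompleteSpace H] {R : VonNeumannAlgebra H} (p : Projection R) : Projection R :=
  ⟨1 - p.val, sub_mem (one_mem R) p.mem, p.isStarProjection.one_sub⟩

/-! ### Spectral families of operators and observable functions -/

/-- `E` is the spectral family of the bounded selfadjoint operator `A` in `R`: it is a bounded
spectral family of projections in `R` and `A = ∫ s dE_s`, i.e. `⟨A x, x⟩ = ∫ s d⟨E_s x, x⟩` for
all `x`, where `d⟨E_s x, x⟩` is the Borel measure on `ℝ` with distribution function
`s ↦ ⟨E_s x, x⟩`. This measure is finite and lives on a bounded interval, so the integral always
converges. -/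
structure IsSpectralFamilyOf {H : Type*} [NormedAddCommGroup H] [InnerProductSpace ℂ H]
    [CompleteSpace H] {R : VonNeumannAlgebra H} (E : ℝ → Projection R) (A : H →L[ℂ] H) :
    Prop extends IsBoundedSpectralFamily E where
  integral_repr : ∀ x : H, ∃ μ : Measure ℝ,
    (∀ s : ℝ, μ (Set.Iic s) = ENNReal.ofReal (inner ℂ ((E s).val x) x).re) ∧
    inner ℂ (A x) x = ((∫ s, s ∂μ : ℝ) : ℂ)

/-- The set `O(R)` of observable functions `f_A(𝔅) = inf {s | E^A_s ∈ 𝔅}`, where `A` runs through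
the selfadjoint elements of `R` and `E^A` is the spectral family of `A`. -/
def observableFunctions {H : Type*} [NormedAddCommGroup H] [InnerProductSpace ℂ H]
    [CompleteSpace H] (R : VonNeumannAlgebra H) : Set (StoneSpectrum (Projection R) → ℝ) :=
  {f | ∃ A ∈ R, IsSelfAdjoint A ∧ ∃ E : ℝ → Projection R, IsSpectralFamilyOf E A ∧
    f = observableFunctionOfFamily E}

/-- The set of mirrored observable functions `g_A(𝔅) = sup {s | I - E^A_s ∈ 𝔅}`, where `A` runs
through the selfadjoint elements of `R` and `E^A` is the spectral family of `A`. -/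
def mirroredObservableFunctions {H : Type*} [NormedAddCommGroup H] [InnerProductSpace ℂ H]
    [CompleteSpace H] (R : VonNeumannAlgebra H) : Set (StoneSpectrum (Projection R) → ℝ) :=
  {g | ∃ A ∈ R, IsSelfAdjoint A ∧ ∃ E : ℝ → Projection R, IsSpectralFamilyOf E A ∧
    g = fun B => sSup {s : ℝ | (E s).compl ∈ B.carrier}}

end VonNeumannAlgebra

/-! Reflecting a spectral family, `E_s ↦ I - E_{(-s)-}`, gives the spectral family of `-A`. Since
`sSup` and `sInf` ignore end points, `g_A = -f_{-A}` and `g_{-A} = -f_A`; this identifies `-O(R)`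
with the mirrored functions for every `R`.

If `R` is abelian, each quasipoint contains exactly one of `p`, `I - p`, so `g_A` is the supremum of
the complement of the up-set whose infimum is `f_A`. Hence `f_A = g_A`.

Conversely, for a projection `e` the function of `I - e` is at most 0 on quasipoints containing `e`
and at least 1 on the others. If its negative is again an observable function, a spectral projection
`q` of the corresponding operator lies in exactly the quasipoints that omit `e`. This forces `q = I
- e`, so every quasipoint decides `e` (`compl_eq_of_mem_iff_notMem`). Then every `r` splits as `(r ⊓
e) + (r ⊓ e.compl)` and commutes with `e` (`eq_inf_add_inf_compl`). Commuting projections make `R`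
abelian by a dyadic approximation with symmetries `1 - 2e`. -/

/-! ### Quasipoints of a bounded lattice. -/

theorem StoneSpectrum.exists_mem {L : Type*} [Lattice L] [BoundedOrder L] {r : L}
    (hr : r ≠ ⊥) : ∃ B : StoneSpectrum L, r ∈ B.carrier := by
  have hI : IsDualIdeal (Set.Ici r) :=
    ⟨⟨r, le_rfl⟩, fun h => hr (le_bot_iff.mp h), fun a ha b hb => le_inf ha hb,
      fun a ha b hab => le_trans ha hab⟩
  obtain ⟨m, hm, hmax⟩ := zorn_subset_nonempty {J : Set L | IsDualIdeal J} (fun c hc hchain hne => by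
    refine ⟨⋃₀ c, ?_, fun s hs => Set.subset_sUnion_of_mem hs⟩
    obtain ⟨J, hJ⟩ := hne
    refine ⟨?_, ?_, ?_, ?_⟩
    · obtain ⟨x, hx⟩ := (hc hJ).nonempty
      exact ⟨x, J, hJ, hx⟩
    · rintro ⟨K, hK, hbot⟩
      exact (hc hK).bot_notMem hbot
    · rintro a ⟨K, hK, ha⟩ b ⟨K', hK', hb⟩
      rcases hchain.total hK hK' with h | h
      · exact ⟨K', hK', (hc hK').inf_mem a (h ha) b hb⟩
      · exact ⟨K, hK, (hc hK).inf_mem a ha b (h hb)⟩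
    · rintro a ⟨K, hK, ha⟩ b hab
      exact ⟨K, hK, (hc hK).mem_of_le a ha b hab⟩) _ hI
  exact ⟨⟨m, hmax⟩, hm le_rfl⟩

namespace StoneSpectrum

variable {L : Type*} [Lattice L] [BoundedOrder L] (B : StoneSpectrum L)

theorem isDualIdeal : IsDualIdeal B.carrier := B.maximal.prop

theorem mem_of_le {a b : L} (ha : a ∈ B.carrier) (h : a ≤ b) : b ∈ B.carrier :=
  B.isDualIdeal.mem_of_le a ha b h

theorem top_mem : ⊤ ∈ B.carrier := by
  obtain ⟨x, hx⟩ := B.isDualIdeal.nonempty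
  exact B.mem_of_le hx le_top

theorem inf_ne_bot {a b : L} (ha : a ∈ B.carrier) (hb : b ∈ B.carrier) : a ⊓ b ≠ ⊥ :=
  fun h => B.isDualIdeal.bot_notMem (h ▸ B.isDualIdeal.inf_mem a ha b hb)

/-- Otherwise `B` and `p` would generate a strictly larger dual ideal, against maximality. -/
theorem exists_inf_eq_bot {p : L} (hp : p ∉ B.carrier) : ∃ q ∈ B.carrier, q ⊓ p = ⊥ := by
  by_contra! h
  refine hp (B.maximal.le_of_ge (y := {x | ∃ q ∈ B.carrier, q ⊓ p ≤ x}) ⟨⟨⊤, ⊤, B.top_mem, le_top⟩,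
    ?_, ?_, ?_⟩ (fun x hx => ⟨x, hx, inf_le_left⟩) ⟨⊤, B.top_mem, inf_le_right⟩)
  · rintro ⟨q, hq, hle⟩
    exact h q hq (le_bot_iff.mp hle)
  · rintro a ⟨q, hq, ha⟩ b ⟨q', hq', hb⟩
    exact ⟨q ⊓ q', B.isDualIdeal.inf_mem q hq q' hq', le_inf
      ((inf_le_inf_right p inf_le_left).trans ha) ((inf_le_inf_right p inf_le_right).trans hb)⟩
  · rintro a ⟨q, hq, ha⟩ b hab
    exact ⟨q, hq, ha.trans hab⟩

end StoneSpectrum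

/-! ### Orthocomplements and orthomodularity. -/

namespace VonNeumannAlgebra

variable {H : Type*} [NormedAddCommGroup H] [InnerProductSpace ℂ H] [CompleteSpace H]
  {R : VonNeumannAlgebra H}

namespace Projection

theorem le_iff_mul_eq (p q : Projection R) : p ≤ q ↔ q.val * p.val = p.val :=
  IsStarProjection.le_iff_mul_eq_right p.isStarProjection q.isStarProjection

theorem le_iff_mul_eq' (p q : Projection R) : p ≤ q ↔ p.val * q.val = p.val :=
  IsStarProjection.le_iff_mul_eq_left p.isStarProjection q.isStarProjection

theorem bot_val : (⊥ : Projection R).val = 0 := by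
  have h : (⊥ : Projection R) ≤ ⟨0, zero_mem R, .zero _⟩ := bot_le
  rw [le_iff_mul_eq] at h
  simpa using h.symm

theorem top_val : (⊤ : Projection R).val = 1 := by
  have h : (⟨1, one_mem R, .one _⟩ : Projection R) ≤ ⊤ := le_top
  rw [le_iff_mul_eq] at h
  simpa using h

theorem compl_val (p : Projection R) : p.compl.val = 1 - p.val := rfl

theorem compl_compl (p : Projection R) : p.compl.compl = p :=
  Projection.ext (sub_sub_cancel _ _)

theorem compl_le_compl {p q : Projection R} (h : p ≤ q) : q.compl ≤ p.compl :=
  sub_le_sub_left (show p.val ≤ q.val from h) 1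

/-- Orthocomplementation as an order isomorphism onto the dual lattice. -/
def complIso (R : VonNeumannAlgebra H) : Projection R ≃o (Projection R)ᵒᵈ where
  toFun p := OrderDual.toDual p.compl
  invFun p := (OrderDual.ofDual p).compl
  left_inv := compl_compl
  right_inv p := compl_compl _
  map_rel_iff' {p q} := ⟨fun h => by
    have h' : p.compl.compl ≤ q.compl.compl := compl_le_compl (OrderDual.toDual_le_toDual.mp h)
    rwa [compl_compl, compl_compl] at h', compl_le_compl⟩

theorem compl_iSup {ι : Sort*} (f : ι → Projection R) : (⨆ i, f i).compl = ⨅ i, (f i).compl :=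
  (complIso R).map_iSup f

theorem compl_bot : (⊥ : Projection R).compl = ⊤ := (complIso R).map_bot

theorem compl_top : (⊤ : Projection R).compl = ⊥ := (complIso R).map_top

theorem inf_compl (p : Projection R) : p ⊓ p.compl = ⊥ := by
  have h1 := (le_iff_mul_eq _ _).mp (inf_le_left : p ⊓ p.compl ≤ p)
  have h2 := (le_iff_mul_eq _ _).mp (inf_le_right : p ⊓ p.compl ≤ p.compl)
  apply Projection.ext
  rw [compl_val, sub_mul, h1, one_mul, sub_self] at h2
  rw [bot_val, ← h2]

/-- The orthomodular law. -/
theorem eq_of_le_of_inf_compl_eq_bot {p q : Projection R} (h : p ≤ q) (h0 : q ⊓ p.compl = ⊥) :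
    p = q := by
  have hs := (IsStarProjection.le_iff_sub p.isStarProjection q.isStarProjection).mp h
  let d : Projection R := ⟨q.val - p.val, sub_mem q.mem p.mem, hs⟩
  have hpq := (le_iff_mul_eq _ _).mp h
  have hpq' := (le_iff_mul_eq' _ _).mp h
  have hd : d ≤ q ⊓ p.compl := by
    refine le_inf ((le_iff_mul_eq _ _).mpr ?_) ((le_iff_mul_eq _ _).mpr ?_)
    · simp [d, mul_sub, hpq, q.isStarProjection.isIdempotentElem.eq]
    · simp [d, compl_val, mul_sub, sub_mul, hpq', p.isStarProjection.isIdempotentElem.eq]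
  rw [h0, le_bot_iff] at hd
  have := congrArg Projection.val hd
  rw [bot_val] at this
  exact Projection.ext (sub_eq_zero.mp this).symm

end Projection

/-! ### Quasipoints and commutation of projections. -/

namespace Projection

/-- Let `t` be the sum on the right, a projection below `r`. A quasipoint through `r ⊓ t.compl`
would contain `r` and one of `e`, `e.compl`, hence one of the summands, which is disjoint from
`t.compl`. So that meet is zero and orthomodularity gives `t = r`. -/
theorem eq_inf_add_inf_compl {e : Projection R}
    (he : ∀ B : StoneSpectrum (Projection R), e ∈ B.carrier ∨ e.compl ∈ B.carrier)
    (r : Projection R) : r.val = (r ⊓ e).val + (r ⊓ e.compl).val := by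
  set m := r ⊓ e
  set n := r ⊓ e.compl
  have hmr : r.val * m.val = m.val := (le_iff_mul_eq _ _).mp (inf_le_left : m ≤ r)
  have hnr : r.val * n.val = n.val := (le_iff_mul_eq _ _).mp (inf_le_left : n ≤ r)
  have hme : m.val * e.val = m.val := (le_iff_mul_eq' _ _).mp (inf_le_right : m ≤ e)
  have hne : e.compl.val * n.val = n.val := (le_iff_mul_eq _ _).mp (inf_le_right : n ≤ e.compl)
  have hmn : m.val * n.val = 0 := by
    rw [← hme, ← hne, compl_val, mul_assoc, ← mul_assoc e.val,
      e.isStarProjection.mul_one_sub_self, zero_mul, mul_zero]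
  have hnm : n.val * m.val = 0 := by
    simpa [m.isStarProjection.isSelfAdjoint.star_eq, n.isStarProjection.isSelfAdjoint.star_eq]
      using congrArg star hmn
  let t : Projection R := ⟨m.val + n.val, add_mem m.mem n.mem,
    m.isStarProjection.add n.isStarProjection hmn⟩
  have htr : t ≤ r := (le_iff_mul_eq _ _).mpr (by simp [t, mul_add, hmr, hnr])
  have hmt : m ≤ t := (le_iff_mul_eq _ _).mpr
    (by simp [t, add_mul, hnm, m.isStarProjection.isIdempotentElem.eq])
  have hnt : n ≤ t := (le_iff_mul_eq _ _).mpr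
    (by simp [t, add_mul, hmn, n.isStarProjection.isIdempotentElem.eq])
  have h0 : r ⊓ t.compl = ⊥ := by
    by_contra h
    obtain ⟨B, hB⟩ := StoneSpectrum.exists_mem h
    have hr := B.mem_of_le hB inf_le_left
    have ht := B.mem_of_le hB inf_le_right
    rcases he B with h | h
    · exact B.inf_ne_bot (B.isDualIdeal.inf_mem _ hr _ h)
        (B.mem_of_le ht (compl_le_compl hmt)) (inf_compl m)
    · exact B.inf_ne_bot (B.isDualIdeal.inf_mem _ hr _ h)
        (B.mem_of_le ht (compl_le_compl hnt)) (inf_compl n)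
  exact (congrArg Projection.val (eq_of_le_of_inf_compl_eq_bot htr h0)).symm

theorem commute_of_mem_or_compl_mem {e : Projection R}
    (he : ∀ B : StoneSpectrum (Projection R), e ∈ B.carrier ∨ e.compl ∈ B.carrier)
    (r : Projection R) : Commute r.val e.val := by
  rw [eq_inf_add_inf_compl he r]
  refine Commute.add_left
    (IsStarProjection.commute_of_le (r ⊓ e).isStarProjection e.isStarProjection
      (inf_le_right : r ⊓ e ≤ e)) ?_
  have h := IsStarProjection.commute_of_le (r ⊓ e.compl).isStarProjection
    e.compl.isStarProjection (inf_le_right : r ⊓ e.compl ≤ e.compl)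
  rw [compl_val] at h
  simpa using (Commute.one_right _).sub_right h

/-- Every nonzero projection lies in some quasipoint, so the hypothesis turns into vanishing meets,
and the orthomodular law turns these into equalities. -/
theorem compl_eq_of_mem_iff_notMem {e q : Projection R}
    (h : ∀ B : StoneSpectrum (Projection R), q ∈ B.carrier ↔ e ∉ B.carrier) : e.compl = q := by
  have hqe : q ⊓ e = ⊥ := by
    by_contra hne
    obtain ⟨B, hB⟩ := StoneSpectrum.exists_mem hne
    exact (h B).mp (B.mem_of_le hB inf_le_left) (B.mem_of_le hB inf_le_right)
  have hle : e.compl ⊓ q = e.compl := by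
    refine eq_of_le_of_inf_compl_eq_bot inf_le_left ?_
    by_contra hne
    obtain ⟨B, hB⟩ := StoneSpectrum.exists_mem hne
    have hc := B.mem_of_le hB inf_le_left
    have hq := (h B).mpr fun he => B.inf_ne_bot he hc (inf_compl e)
    exact B.inf_ne_bot (B.isDualIdeal.inf_mem _ hc _ hq) (B.mem_of_le hB inf_le_right)
      (inf_compl _)
  exact eq_of_le_of_inf_compl_eq_bot (inf_eq_left.mp hle) (by rwa [compl_compl])

theorem commute_of_forall_exists_mem_iff_notMem
    (h : ∀ e : Projection R, ∃ q : Projection R,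
      ∀ B : StoneSpectrum (Projection R), q ∈ B.carrier ↔ e ∉ B.carrier)
    (p e : Projection R) : Commute p.val e.val := by
  refine commute_of_mem_or_compl_mem (fun B => ?_) p
  obtain ⟨q, hq⟩ := h e
  rw [compl_eq_of_mem_iff_notMem hq, hq]
  exact em _

/-- In an abelian von Neumann algebra every quasipoint is an ultrafilter. -/
theorem compl_mem_iff_notMem_of_commute (hR : ∀ a ∈ R, ∀ b ∈ R, a * b = b * a)
    (B : StoneSpectrum (Projection R)) (p : Projection R) :
    p.compl ∈ B.carrier ↔ p ∉ B.carrier := by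
  refine ⟨fun h hp => B.inf_ne_bot hp h (inf_compl p), fun hp => ?_⟩
  obtain ⟨q, hq, hqp⟩ := B.exists_inf_eq_bot hp
  have hc := hR q.val q.mem p.val p.mem
  -- The product of commuting projections is a projection below both; here it must vanish, which
  -- says `q ≤ p.compl`.
  let t : Projection R := ⟨q.val * p.val, mul_mem q.mem p.mem,
    q.isStarProjection.mul p.isStarProjection hc⟩
  have ht : t ≤ q ⊓ p := by
    refine le_inf ((le_iff_mul_eq _ _).mpr ?_) ((le_iff_mul_eq' _ _).mpr ?_)
    · simp [t, ← mul_assoc, q.isStarProjection.isIdempotentElem.eq]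
    · simp [t, mul_assoc, p.isStarProjection.isIdempotentElem.eq]
  rw [hqp, le_bot_iff] at ht
  have h0 := congrArg Projection.val ht
  rw [bot_val] at h0
  refine B.mem_of_le hq ((le_iff_mul_eq' _ _).mpr ?_)
  rw [compl_val, mul_sub, mul_one, show q.val * p.val = 0 from h0, sub_zero]

end Projection

/-! ### From commuting projections to a commutative algebra. -/

/-- The projection onto the kernel of the positive part of a selfadjoint element. -/
theorem exists_projection_posPart (a : H →L[ℂ] H) (haR : a ∈ R) :
    ∃ e : Projection R, a⁺ * e.val = 0 ∧ e.val * a⁻ = a⁻ := by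
  have hcl : IsClosed ((a⁺).ker : Set H) := (a⁺).isClosed_ker
  have : CompleteSpace (a⁺).ker := hcl.completeSpace_coe
  refine ⟨⟨(a⁺).ker.starProjection, ?_, isStarProjection_starProjection⟩, ?_, ?_⟩
  · rw [VonNeumannAlgebra.IsStarProjection.mem_iff isStarProjection_starProjection]
    intro y hy
    rw [Submodule.range_starProjection, Module.End.mem_invtSubmodule]
    intro x hx
    -- As a function of `a`, the positive part commutes with the commutant, so its kernel is
    -- invariant under it.
    have hc : Commute a⁺ y := by
      rw [CFC.posPart_def]
      exact Commute.cfcₙ_real (mem_commutant_iff.mp hy a haR) _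
    have hx' : a⁺ x = 0 := hx
    change a⁺ (y x) = 0
    rw [← mul_apply_eq_comp, hc.eq, mul_apply_eq_comp, hx', map_zero]
  · ext x
    exact ((a⁺).ker.starProjection_apply_mem x :)
  · ext x
    refine Submodule.starProjection_eq_self_iff.mpr ?_
    exact congrArg (fun T : H →L[ℂ] H => T x) (CFC.posPart_mul_negPart a)

/-- The first step of the dyadic expansion of a selfadjoint contraction by symmetries. -/
theorem exists_projection_norm_two_smul_sub_le (a : H →L[ℂ] H) (haR : a ∈ R)
    (ha : IsSelfAdjoint a) (h1 : ‖a‖ ≤ 1) :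
    ∃ e : Projection R, ‖a + a - (1 - 2 * e.val)‖ ≤ 1 := by
  obtain ⟨e, he1, he2⟩ := exists_projection_posPart a haR
  refine ⟨e, ?_⟩
  have hpos : IsSelfAdjoint a⁺ := (CFC.posPart_nonneg a).isSelfAdjoint
  have he1' : e.val * a⁺ = 0 := by
    simpa [hpos.star_eq, e.isStarProjection.isSelfAdjoint.star_eq] using congrArg star he1
  -- Polar decomposition: `1 - 2e` fixes `a⁺` and negates `a⁻`, so `a = (1 - 2e)|a|`. The unitary
  -- factor drops out of the norm, leaving `|2|x| - 1| ≤ 1` on the spectrum.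
  have key : a + a - (1 - 2 * e.val) = -(2 * e.val - 1) * (CFC.abs a + CFC.abs a - 1) := by
    rw [← CFC.posPart_add_negPart a ha]
    nth_rewrite 1 2 [← CFC.posPart_sub_negPart a ha]
    have : -(2 * e.val - 1) * (a⁺ + a⁻ + (a⁺ + a⁻) - 1) =
      -(4 * (e.val * a⁺)) - 4 * (e.val * a⁻) + 2 * a⁺ + 2 * a⁻ - (1 - 2 * e.val) := by noncomm_ring
    rw [this, he1', he2]
    noncomm_ring
  have hu := IsStarProjection.two_mul_sub_one_mem_unitary e.isStarProjection
  rw [key, neg_mul, norm_neg, CStarRing.norm_mem_unitary_mul _ hu, CFC.abs_eq_cfc_norm a ha]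
  have : cfc (fun x : ℝ => ‖x‖) a + cfc (fun x : ℝ => ‖x‖) a - 1 =
      cfc (fun x : ℝ => ‖x‖ + ‖x‖ - 1) a := by
    rw [cfc_sub (fun x : ℝ => ‖x‖ + ‖x‖) (fun _ => 1) a, cfc_add .., cfc_const_one ℝ a]
  rw [this]
  refine norm_cfc_le zero_le_one fun x hx => ?_
  have hx1 : ‖x‖ ≤ 1 := by
    refine (spectrum.norm_le_norm_mul_of_mem hx).trans ((mul_le_of_le_one_right (norm_nonneg a)
      ContinuousLinearMap.norm_id_le).trans h1)
  rw [Real.norm_eq_abs, abs_le]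
  constructor <;> linarith [norm_nonneg x]

/-- Replacing `c` by `2c - (1 - 2e)` stays in the unit ball and doubles the commutator with `b`,
since `b` commutes with `e`. Commutators on the unit ball are bounded by `2‖b‖`, so iteration forces
them to vanish. -/
theorem commute_of_forall_projection_of_norm_le_one {b : H →L[ℂ] H}
    (hb : ∀ e : Projection R, Commute e.val b) {a : H →L[ℂ] H} (haR : a ∈ R)
    (ha : IsSelfAdjoint a) (ha1 : ‖a‖ ≤ 1) : Commute a b := by
  have step : ∀ n : ℕ, ∀ c ∈ R, IsSelfAdjoint c → ‖c‖ ≤ 1 →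
      ‖c * b - b * c‖ ≤ 2 * ‖b‖ * (1 / 2) ^ n := by
    intro n
    induction n with
    | zero =>
      intro c _ _ hc
      have h1 : ‖c * b‖ ≤ 1 * ‖b‖ := (norm_mul_le _ _).trans (by gcongr)
      have h2 : ‖b * c‖ ≤ ‖b‖ * 1 := (norm_mul_le _ _).trans (by gcongr)
      linarith [norm_sub_le (c * b) (b * c)]
    | succ n ih =>
      intro c hcR hc hc1
      obtain ⟨e, he⟩ := exists_projection_norm_two_smul_sub_le c hcR hc hc1
      have h2 : (2 : H →L[ℂ] H) * e.val = e.val + e.val := two_mul _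
      have hmem : c + c - (1 - 2 * e.val) ∈ R := by
        rw [h2]
        exact sub_mem (add_mem hcR hcR) (sub_mem (one_mem R) (add_mem e.mem e.mem))
      have hsa : IsSelfAdjoint (c + c - (1 - 2 * e.val)) := by
        rw [h2]
        have := e.isStarProjection.isSelfAdjoint
        exact (hc.add hc).sub ((IsSelfAdjoint.one _).sub (this.add this))
      have h := ih _ hmem hsa he
      have heq : (c + c - (1 - 2 * e.val)) * b - b * (c + c - (1 - 2 * e.val)) =
          (2 : ℝ) • (c * b - b * c) := by
        have : (c + c - (1 - 2 * e.val)) * b - b * (c + c - (1 - 2 * e.val)) =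
          2 * (c * b - b * c) + 2 * (e.val * b - b * e.val) := by noncomm_ring
        rw [this, (hb e).eq, sub_self, mul_zero, add_zero, two_smul, two_mul]
      rw [heq, norm_smul, Real.norm_eq_abs, abs_two] at h
      rw [pow_succ]
      linarith
  have hlim : Filter.Tendsto (fun n : ℕ => 2 * ‖b‖ * (1 / 2 : ℝ) ^ n) Filter.atTop (nhds 0) := by
    simpa using (tendsto_pow_atTop_nhds_zero_of_lt_one (by norm_num : (0 : ℝ) ≤ 1 / 2)
      (by norm_num)).const_mul (2 * ‖b‖)
  have h0 : ‖a * b - b * a‖ ≤ 0 := ge_of_tendsto' hlim fun n => step n a haR ha ha1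
  exact sub_eq_zero.mp (norm_le_zero_iff.mp h0)

theorem complex_smul_mem (z : ℂ) {a : H →L[ℂ] H} (ha : a ∈ R) : z • a ∈ R :=
  show z • a ∈ R.toStarSubalgebra from R.toStarSubalgebra.smul_mem ha z

theorem commute_of_forall_projection_of_isSelfAdjoint {b : H →L[ℂ] H}
    (hb : ∀ e : Projection R, Commute e.val b) {a : H →L[ℂ] H} (haR : a ∈ R)
    (ha : IsSelfAdjoint a) : Commute a b := by
  rcases eq_or_ne a 0 with rfl | hne
  · exact Commute.zero_left b
  have hpos : (‖a‖ : ℂ) ≠ 0 := by exact_mod_cast norm_ne_zero_iff.mpr hne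
  have h := commute_of_forall_projection_of_norm_le_one hb (complex_smul_mem (‖a‖ : ℂ)⁻¹ haR)
    (by rw [isSelfAdjoint_iff, star_smul, ha.star_eq]; simp)
    (by rw [norm_smul, norm_inv, Complex.norm_real, norm_norm,
      inv_mul_cancel₀ (norm_ne_zero_iff.mpr hne)])
  have h' := h.smul_left (‖a‖ : ℂ)
  rwa [smul_smul, mul_inv_cancel₀ hpos, one_smul] at h'

/-- An operator commuting with all projections of `R` commutes with all of `R`. -/
theorem commute_of_forall_projection {b : H →L[ℂ] H}
    (hb : ∀ e : Projection R, Commute e.val b) {a : H →L[ℂ] H} (ha : a ∈ R) : Commute a b := by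
  have hsum : (a + star a) + (a - star a) = (2 : ℂ) • a := by rw [two_smul]; abel
  have hI : Commute (Complex.I • (a - star a)) b := by
    refine commute_of_forall_projection_of_isSelfAdjoint hb
      (complex_smul_mem _ (sub_mem ha (star_mem ha))) ?_
    rw [isSelfAdjoint_iff, star_smul, star_sub, star_star, RCLike.star_def, Complex.conj_I,
      neg_smul, ← smul_neg, neg_sub]
  have hI' := hI.smul_left (-Complex.I)
  rw [smul_smul, neg_mul, Complex.I_mul_I, neg_neg, one_smul] at hI'
  have h2 := ((commute_of_forall_projection_of_isSelfAdjoint hb (add_mem ha (star_mem ha))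
    (.add_star_self a)).add_left hI').smul_left (2⁻¹ : ℂ)
  rwa [hsum, smul_smul, inv_mul_cancel₀ two_ne_zero, one_smul] at h2

theorem mul_comm_of_projections_commute (h : ∀ p e : Projection R, Commute p.val e.val) :
    ∀ a ∈ R, ∀ b ∈ R, a * b = b * a := fun _ ha _ hb =>
  commute_of_forall_projection
    (fun e => (commute_of_forall_projection (fun p => h p e) hb).symm) ha

/-! ### Joins of projections as strong limits. -/

namespace Projection

theorem hasOrthogonalProjection_range (p : Projection R) :
    p.val.range.HasOrthogonalProjection :=
  have : CompleteSpace p.val.range := (isClosed_range p).completeSpace_coe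
  inferInstance

theorem val_eq_of_range_eq (p : Projection R) (K : Submodule ℂ H) [K.HasOrthogonalProjection]
    (h : p.val.range = K) : p.val = K.starProjection := by
  subst h
  obtain ⟨_, h⟩ := isStarProjection_iff_eq_starProjection_range.mp p.isStarProjection
  exact h

/-- The lattice structure defines joins only through meets of upper bounds. The closed span of the
ranges is invariant under the commutant, so its projection lies in `R` and is the least upper bound.
-/
theorem range_iSup {ι : Type*} (f : ι → Projection R) :
    (⨆ i, f i).val.range = (⨆ i, (f i).val.range).topologicalClosure := by
  set K := (⨆ i, (f i).val.range).topologicalClosure with hK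
  have : CompleteSpace K := (Submodule.isClosed_topologicalClosure _).completeSpace_coe
  have hKR : K.starProjection ∈ R := by
    rw [VonNeumannAlgebra.IsStarProjection.mem_iff isStarProjection_starProjection]
    intro y hy
    rw [Submodule.range_starProjection, Module.End.mem_invtSubmodule]
    have hinv : (⨆ i, (f i).val.range) ≤ (⨆ i, (f i).val.range).comap (y : H →ₗ[ℂ] H) := by
      refine iSup_le fun i x hx => ?_
      exact Submodule.mem_iSup_of_mem i
        ((VonNeumannAlgebra.IsStarProjection.mem_iff (f i).isStarProjection R).mp (f i).mem y hy hx)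
    refine Submodule.topologicalClosure_minimal _
      (hinv.trans (Submodule.comap_mono (Submodule.le_topologicalClosure _))) ?_
    exact (Submodule.isClosed_topologicalClosure _).preimage y.continuous
  let k : Projection R := ⟨K.starProjection, hKR, isStarProjection_starProjection⟩
  have hk : k.val.range = K := Submodule.range_starProjection _
  apply le_antisymm
  · rw [← hk, ← le_iff_range_le]
    refine iSup_le fun i => ?_
    rw [le_iff_range_le, hk]
    exact (le_iSup (fun i => (f i).val.range) i).trans (Submodule.le_topologicalClosure _)
  · refine Submodule.topologicalClosure_minimal _ (iSup_le fun i => ?_) (isClosed_range _)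
    rw [← le_iff_range_le]
    exact le_iSup f i

/-- An increasing family of projections converges strongly to its join. -/
theorem tendsto_iSup {ι : Type*} [Preorder ι] {f : ι → Projection R} (hf : Monotone f) (x : H) :
    Filter.Tendsto (fun i => (f i).val x) Filter.atTop (nhds ((⨆ i, f i).val x)) := by
  have : ∀ i, (f i).val.range.HasOrthogonalProjection := fun i => hasOrthogonalProjection_range _
  have : CompleteSpace (⨆ i, (f i).val.range).topologicalClosure :=
    (Submodule.isClosed_topologicalClosure _).completeSpace_coe
  have h := Submodule.starProjection_tendsto_closure_iSup (fun i => (f i).val.range)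
    (fun i j hij => (le_iff_range_le _ _).mp (hf hij)) x
  rw [← val_eq_of_range_eq _ _ (range_iSup f)] at h
  exact h.congr fun i => by rw [← val_eq_of_range_eq (f i) _ rfl]

theorem re_inner_nonneg (p : Projection R) (x : H) : 0 ≤ (inner ℂ (p.val x) x).re := by
  have h : 0 ≤ p.val := p.isStarProjection.nonneg
  exact ((ContinuousLinearMap.nonneg_iff_isPositive _).mp h).re_inner_nonneg_left x

end Projection

/-! ### Reflection of spectral families. -/

/-- The spectral family `s ↦ I - E_{(-s)-}`. -/
noncomputable def reflectedFamily (E : ℝ → Projection R) (s : ℝ) : Projection R :=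
  (⨆ t : Set.Iio (-s), E t).compl

theorem iSup_Iio_le_of_monotone {L : Type*} [CompleteLattice L] {E : ℝ → L} (hE : Monotone E)
    (s : ℝ) : ⨆ t : Set.Iio s, E t ≤ E s :=
  iSup_le fun t => hE t.2.le

theorem isBoundedSpectralFamily_reflectedFamily {E : ℝ → Projection R}
    (hE : IsBoundedSpectralFamily E) : IsBoundedSpectralFamily (reflectedFamily E) := by
  have hm : Monotone E := fun s t => hE.mono s t
  have hmono : Monotone (reflectedFamily E) := fun s t hst =>
    Projection.compl_le_compl (iSup_le fun u =>
      le_iSup (fun u : Set.Iio (-s) => E u) ⟨u, lt_of_lt_of_le u.2 (neg_le_neg hst)⟩)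
  have hbot : ∃ a, reflectedFamily E a = ⊥ := by
    obtain ⟨b, hb⟩ := hE.bddAbove
    -- The join runs over an open half-line, so the bound is moved past `b` to include `E b = ⊤`.
    refine ⟨-(b + 1), ?_⟩
    rw [reflectedFamily, neg_neg, ← Projection.compl_top, ← hb]
    exact congrArg _ (le_antisymm (hb ▸ le_top)
      (le_iSup (fun u : Set.Iio (b + 1) => E u) ⟨b, lt_add_one b⟩))
  have htop : ∃ b, reflectedFamily E b = ⊤ := by
    obtain ⟨a, ha⟩ := hE.bddBelow
    refine ⟨-a, ?_⟩
    rw [reflectedFamily, neg_neg, ← Projection.compl_bot, ← ha]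
    exact congrArg _ (le_antisymm (iSup_Iio_le_of_monotone hm a) (ha ▸ bot_le))
  refine ⟨⟨fun s t => @hmono s t, fun s => ?_, ?_, ?_⟩, hbot, htop⟩
  · simp only [reflectedFamily]
    rw [← Projection.compl_iSup]
    congr 1
    apply le_antisymm
    · refine iSup_le fun t => ?_
      obtain ⟨u, hu1, hu2⟩ := exists_between (Set.mem_Iio.mp t.2)
      exact le_iSup_of_le ⟨-u, by simpa using lt_neg.mp hu2⟩
        (le_iSup_of_le ⟨t, by simpa using hu1⟩ le_rfl)
    · refine iSup_le fun u => iSup_le fun t => ?_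
      exact le_iSup_of_le ⟨t, Set.mem_Iio.mpr
        ((Set.mem_Iio.mp t.2).trans (neg_lt_neg (Set.mem_Ioi.mp u.2)))⟩ le_rfl
  · obtain ⟨a, ha⟩ := hbot
    exact le_bot_iff.mp (ha ▸ iInf_le _ a)
  · obtain ⟨b, hb⟩ := htop
    exact top_le_iff.mp (hb ▸ le_iSup _ b)

/-- The strict distribution function of the measure `d⟨E_s x, x⟩`. -/
theorem measure_Iio_of_measure_Iic {E : ℝ → Projection R} (hm : Monotone E) {x : H}
    {μ : Measure ℝ}
    (hμ : ∀ s : ℝ, μ (Set.Iic s) = ENNReal.ofReal (inner ℂ ((E s).val x) x).re) (s : ℝ) :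
    μ (Set.Iio s) = ENNReal.ofReal (inner ℂ ((⨆ t : Set.Iio s, E t).val x) x).re := by
  -- Along a sequence increasing to `s`, continuity of `μ` from below and strong convergence of the
  -- projections compute the same limit.
  obtain ⟨u, hu, hus, hlim⟩ := exists_seq_strictMono_tendsto s
  have hsup : ⨆ t : Set.Iio s, E t = ⨆ n, E (u n) := by
    apply le_antisymm
    · refine iSup_le fun t => ?_
      obtain ⟨n, hn⟩ := (hlim.eventually (lt_mem_nhds (Set.mem_Iio.mp t.2))).exists
      exact le_iSup_of_le n (hm hn.le)
    · exact iSup_le fun n => le_iSup (fun t : Set.Iio s => E t) ⟨u n, hus n⟩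
  have h1 : Filter.Tendsto (fun n => μ (Set.Iic (u n))) Filter.atTop (nhds (μ (Set.Iio s))) := by
    rw [← iUnion_Iic_eq_Iio_of_lt_of_tendsto hus hlim]
    exact tendsto_measure_iUnion_atTop fun i j hij => Set.Iic_subset_Iic.mpr (hu.monotone hij)
  have h2 := Projection.tendsto_iSup (f := fun n => E (u n)) (hm.comp hu.monotone) x
  have h3 := ENNReal.tendsto_ofReal
    ((Complex.continuous_re.tendsto _).comp (h2.inner (tendsto_const_nhds (x := x)) (𝕜 := ℂ)))
  rw [hsup]
  refine tendsto_nhds_unique h1 (h3.congr fun n => ?_)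
  rw [hμ]
  rfl

theorem measure_univ_of_measure_Iic {E : ℝ → Projection R} (hE : IsBoundedSpectralFamily E)
    {x : H} {μ : Measure ℝ}
    (hμ : ∀ s : ℝ, μ (Set.Iic s) = ENNReal.ofReal (inner ℂ ((E s).val x) x).re) :
    μ Set.univ = ENNReal.ofReal (inner ℂ x x).re := by
  obtain ⟨b, hb⟩ := hE.bddAbove
  have h := tendsto_measure_Iic_atTop μ
  refine tendsto_nhds_unique h (tendsto_const_nhds.congr' ?_)
  filter_upwards [Filter.eventually_ge_atTop b] with s hs
  have : E s = ⊤ := top_le_iff.mp (hb ▸ hE.mono b s hs)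
  rw [hμ, this, Projection.top_val]
  rfl

/-- The reflected family is the spectral family of `-A`. -/
theorem isSpectralFamilyOf_reflectedFamily {E : ℝ → Projection R} {A : H →L[ℂ] H}
    (hE : IsSpectralFamilyOf E A) : IsSpectralFamilyOf (reflectedFamily E) (-A) := by
  have hm : Monotone E := fun s t => hE.mono s t
  refine ⟨isBoundedSpectralFamily_reflectedFamily hE.toIsBoundedSpectralFamily, fun x => ?_⟩
  obtain ⟨μ, hμ, hint⟩ := hE.integral_repr x
  refine ⟨μ.map Neg.neg, fun s => ?_, ?_⟩
  · have hpre : (Neg.neg : ℝ → ℝ) ⁻¹' Set.Iic s = (Set.Iio (-s))ᶜ := by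
      ext t
      simp
    have hfin : μ (Set.Iio (-s)) ≠ ⊤ := by
      rw [measure_Iio_of_measure_Iic hm hμ]
      exact ENNReal.ofReal_ne_top
    rw [Measure.map_apply measurable_neg measurableSet_Iic, hpre,
      measure_compl measurableSet_Iio hfin, measure_Iio_of_measure_Iic hm hμ,
      measure_univ_of_measure_Iic hE.toIsBoundedSpectralFamily hμ,
      ← ENNReal.ofReal_sub _ (Projection.re_inner_nonneg _ x), reflectedFamily,
      Projection.compl_val, sub_apply, inner_sub_left, Complex.sub_re]
    rfl
  · change _ = ((∫ s, s ∂(μ.map (MeasurableEquiv.neg ℝ)) : ℝ) : ℂ)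
    rw [(MeasurableEquiv.neg ℝ).measurableEmbedding.integral_map]
    simp only [MeasurableEquiv.neg_apply]
    rw [integral_neg, neg_apply, inner_neg_left, hint, Complex.ofReal_neg]

end VonNeumannAlgebra

/-! ### Comparison of observable and mirrored observable functions. -/

/-- `V` and `-U` are half-lines that can differ only at the end point. This absorbs the difference
between `E_s` and its left limit. -/
theorem Real.sSup_eq_neg_sInf_of_interlaced {U V : Set ℝ} (hne : U.Nonempty) (hbdd : BddBelow U)
    (hVU : ∀ s ∈ V, ∀ t, -s < t → t ∈ U) (hUV : ∀ s ∈ U, ∀ t, t < -s → t ∈ V) :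
    sSup V = -sInf U := by
  obtain ⟨u, hu⟩ := hne
  refine IsLUB.csSup_eq ⟨fun v hv => ?_, fun w hw => ?_⟩ ⟨-u - 1, hUV u hu _ (by linarith)⟩
  · rw [le_neg]
    exact le_of_forall_gt_imp_ge_of_dense fun t ht => csInf_le hbdd (hVU v hv t ht)
  · rw [neg_le]
    refine le_csInf ⟨u, hu⟩ fun x hx => ?_
    rw [neg_le]
    exact le_of_forall_lt_imp_le_of_dense fun t ht => hw (hUV x hx t ht)

theorem IsBoundedSpectralFamily.nonempty_setOf_mem {L : Type*} [CompleteLattice L] {E : ℝ → L}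
    (hE : IsBoundedSpectralFamily E) (B : StoneSpectrum L) :
    {s : ℝ | E s ∈ B.carrier}.Nonempty := by
  obtain ⟨b, hb⟩ := hE.bddAbove
  exact ⟨b, show E b ∈ B.carrier from hb ▸ B.top_mem⟩

theorem IsBoundedSpectralFamily.bddBelow_setOf_mem {L : Type*} [CompleteLattice L] {E : ℝ → L}
    (hE : IsBoundedSpectralFamily E) (B : StoneSpectrum L) :
    BddBelow {s : ℝ | E s ∈ B.carrier} := by
  obtain ⟨a, ha⟩ := hE.bddBelow
  refine ⟨a, fun s hs => le_of_not_gt fun hsa => B.isDualIdeal.bot_notMem ?_⟩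
  exact ha ▸ B.mem_of_le hs (hE.mono s a hsa.le)

namespace VonNeumannAlgebra

variable {H : Type*} [NormedAddCommGroup H] [InnerProductSpace ℂ H] [CompleteSpace H]
  {R : VonNeumannAlgebra H}

theorem sSup_compl_mem_eq_neg_observableFunction_reflectedFamily {E : ℝ → Projection R}
    (hE : IsBoundedSpectralFamily E) (B : StoneSpectrum (Projection R)) :
    sSup {s : ℝ | (E s).compl ∈ B.carrier} =
      -observableFunctionOfFamily (reflectedFamily E) B := by
  have hm : Monotone E := fun s t => hE.mono s t
  have hE' := isBoundedSpectralFamily_reflectedFamily hE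
  refine Real.sSup_eq_neg_sInf_of_interlaced (hE'.nonempty_setOf_mem B)
    (hE'.bddBelow_setOf_mem B) (fun s hs t hst => ?_) (fun s hs t hst => ?_)
  · exact B.mem_of_le hs (Projection.compl_le_compl
      ((iSup_Iio_le_of_monotone hm _).trans (hm (neg_lt.mp hst).le)))
  · exact B.mem_of_le hs (Projection.compl_le_compl
      (le_iSup (fun u : Set.Iio (-s) => E u) ⟨t, hst⟩))

/-- This counterpart of the preceding lemma is proved directly, so that reflection need not be shown
to be an involution. -/
theorem sSup_compl_reflectedFamily_mem_eq_neg_observableFunction {E : ℝ → Projection R}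
    (hE : IsBoundedSpectralFamily E) (B : StoneSpectrum (Projection R)) :
    sSup {s : ℝ | (reflectedFamily E s).compl ∈ B.carrier} =
      -observableFunctionOfFamily E B := by
  have hm : Monotone E := fun s t => hE.mono s t
  refine Real.sSup_eq_neg_sInf_of_interlaced (hE.nonempty_setOf_mem B)
    (hE.bddBelow_setOf_mem B) (fun s hs t hst => ?_) (fun s hs t hst => ?_)
  · rw [Set.mem_ofPred_eq, reflectedFamily, Projection.compl_compl] at hs
    exact B.mem_of_le hs ((iSup_Iio_le_of_monotone hm _).trans (hm hst.le))
  · rw [Set.mem_ofPred_eq, reflectedFamily, Projection.compl_compl]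
    exact B.mem_of_le hs (le_iSup (fun u : Set.Iio (-t) => E u) ⟨s, lt_neg.mp hst⟩)

theorem neg_observableFunctions_eq (R : VonNeumannAlgebra H) :
    -observableFunctions R = mirroredObservableFunctions R := by
  ext f
  rw [Set.mem_neg]
  constructor
  · rintro ⟨A, hA, hsa, E, hE, hf⟩
    refine ⟨-A, neg_mem hA, hsa.neg, reflectedFamily E, isSpectralFamilyOf_reflectedFamily hE, ?_⟩
    funext B
    rw [sSup_compl_reflectedFamily_mem_eq_neg_observableFunction hE.toIsBoundedSpectralFamily,
      ← hf, Pi.neg_apply, neg_neg]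
  · rintro ⟨A, hA, hsa, E, hE, rfl⟩
    refine ⟨-A, neg_mem hA, hsa.neg, reflectedFamily E, isSpectralFamilyOf_reflectedFamily hE, ?_⟩
    funext B
    rw [Pi.neg_apply,
      sSup_compl_mem_eq_neg_observableFunction_reflectedFamily hE.toIsBoundedSpectralFamily,
      neg_neg]

/-- Quasipoints are ultrafilters here, so the two index sets are complementary half-lines with a
common end point. -/
theorem sSup_compl_mem_eq_observableFunction_of_commute
    (hR : ∀ a ∈ R, ∀ b ∈ R, a * b = b * a) {E : ℝ → Projection R}
    (hE : IsBoundedSpectralFamily E) (B : StoneSpectrum (Projection R)) :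
    sSup {s : ℝ | (E s).compl ∈ B.carrier} = observableFunctionOfFamily E B := by
  simp only [Projection.compl_mem_iff_notMem_of_commute hR B]
  have hne := hE.nonempty_setOf_mem B
  have hbdd := hE.bddBelow_setOf_mem B
  have hup : ∀ s t, s ≤ t → E s ∈ B.carrier → E t ∈ B.carrier :=
    fun s t hst hs => B.mem_of_le hs (hE.mono s t hst)
  obtain ⟨a, ha⟩ := hE.bddBelow
  refine IsLUB.csSup_eq ⟨fun s hs => ?_, fun w hw => ?_⟩
    ⟨a, show E a ∉ B.carrier from ha ▸ B.isDualIdeal.bot_notMem⟩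
  · exact le_csInf hne fun t ht => le_of_not_gt fun hts => hs (hup t s hts.le ht)
  · refine le_of_forall_lt_imp_le_of_dense fun t ht => hw ?_
    exact fun hmem => absurd (csInf_le hbdd hmem) (not_le.mpr ht)

theorem observableFunctions_eq_mirrored_of_commute (hR : ∀ a ∈ R, ∀ b ∈ R, a * b = b * a) :
    observableFunctions R = mirroredObservableFunctions R := by
  ext f
  refine exists_congr fun A => and_congr_right fun _ => and_congr_right fun _ =>
    exists_congr fun E => and_congr_right fun hE => ?_
  rw [funext (sSup_compl_mem_eq_observableFunction_of_commute hR hE.toIsBoundedSpectralFamily)]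

/-! ### Two-valued observables and the converse. -/

/-- The spectral family of the projection `I - e`. -/
noncomputable def projectionFamily (e : Projection R) (s : ℝ) : Projection R :=
  if s < 0 then ⊥ else if s < 1 then e else ⊤

theorem isBoundedSpectralFamily_projectionFamily (e : Projection R) :
    IsBoundedSpectralFamily (projectionFamily e) := by
  have hmono : Monotone (projectionFamily e) := by
    intro s t hst
    unfold projectionFamily
    split_ifs <;> first | exact le_rfl | exact bot_le | exact le_top | (exfalso; linarith)
  have hbot : projectionFamily e (-1) = ⊥ := by norm_num [projectionFamily]
  have htop : projectionFamily e 1 = ⊤ := by norm_num [projectionFamily]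
  refine ⟨⟨fun s t => @hmono s t, fun s => ?_, ?_, ?_⟩, ⟨-1, hbot⟩, ⟨1, htop⟩⟩
  · refine le_antisymm (le_iInf fun t => hmono (Set.mem_Ioi.mp t.2).le) ?_
    -- The family is constant just to the right of `s`, so one such `t` bounds the meet.
    obtain ⟨t, hst, ht⟩ : ∃ t, s < t ∧ projectionFamily e t = projectionFamily e s := by
      by_cases h0 : s < 0
      · exact ⟨s / 2, by linarith, by
          rw [projectionFamily, projectionFamily, if_pos h0, if_pos (by linarith)]⟩
      by_cases h1 : s < 1
      · exact ⟨(s + 1) / 2, by linarith, by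
          rw [projectionFamily, projectionFamily, if_neg h0, if_pos h1, if_neg (by linarith),
            if_pos (by linarith)]⟩
      · exact ⟨s + 1, by linarith, by
          rw [projectionFamily, projectionFamily, if_neg h0, if_neg h1, if_neg (by linarith),
            if_neg (by linarith)]⟩
    exact ht ▸ iInf_le (fun t : Set.Ioi s => projectionFamily e t) ⟨t, hst⟩
  · exact le_bot_iff.mp (hbot ▸ iInf_le _ (-1))
  · exact top_le_iff.mp (htop ▸ le_iSup _ 1)

theorem isSpectralFamilyOf_projectionFamily (e : Projection R) :
    IsSpectralFamilyOf (projectionFamily e) e.compl.val := by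
  refine ⟨isBoundedSpectralFamily_projectionFamily e, fun x => ?_⟩
  have h0 := Projection.re_inner_nonneg e x
  have h1 := Projection.re_inner_nonneg e.compl x
  have hadd : (inner ℂ (e.val x) x).re + (inner ℂ (e.compl.val x) x).re = (inner ℂ x x).re := by
    rw [← Complex.add_re, ← inner_add_left, Projection.compl_val, sub_apply]
    congr 2
    exact add_sub_cancel _ _
  refine ⟨ENNReal.ofReal (inner ℂ (e.val x) x).re • Measure.dirac 0 +
    ENNReal.ofReal (inner ℂ (e.compl.val x) x).re • Measure.dirac 1, fun s => ?_, ?_⟩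
  · simp only [Measure.add_apply, Measure.smul_apply, smul_eq_mul,
      Measure.dirac_apply' _ measurableSet_Iic, projectionFamily]
    by_cases hs0 : s < 0
    · simp [hs0, hs0.trans zero_lt_one, Projection.bot_val]
    by_cases hs1 : s < 1
    · simp [hs0, hs1, not_lt.mp hs0]
    · simp only [hs0, hs1, if_false, Projection.top_val]
      rw [Set.indicator_of_mem (Set.mem_Iic.mpr (not_lt.mp hs0)),
        Set.indicator_of_mem (Set.mem_Iic.mpr (not_lt.mp hs1))]
      simp only [Pi.one_apply, mul_one]
      rw [← ENNReal.ofReal_add h0 h1, hadd]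
      rfl
  · have hi : ∀ (c : ℝ) (a : ℝ), Integrable (fun s : ℝ => s)
        (ENNReal.ofReal c • Measure.dirac a) := fun c a =>
      (integrable_dirac (by simp)).smul_measure ENNReal.ofReal_ne_top
    rw [integral_add_measure (hi _ _) (hi _ _), integral_smul_measure, integral_smul_measure,
      integral_dirac, integral_dirac, ENNReal.toReal_ofReal h1, smul_zero, zero_add, smul_eq_mul,
      mul_one]
    have hpos : e.compl.val.IsPositive :=
      (ContinuousLinearMap.nonneg_iff_isPositive _).mp e.compl.isStarProjection.nonneg
    exact (hpos.isSymmetric.coe_re_inner_apply_self x).symm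

theorem observableFunction_projectionFamily_of_mem {e : Projection R}
    {B : StoneSpectrum (Projection R)} (he : e ∈ B.carrier) :
    observableFunctionOfFamily (projectionFamily e) B ≤ 0 := by
  refine csInf_le ((isBoundedSpectralFamily_projectionFamily e).bddBelow_setOf_mem B) ?_
  simpa [projectionFamily] using he

theorem observableFunction_projectionFamily_of_notMem {e : Projection R}
    {B : StoneSpectrum (Projection R)} (he : e ∉ B.carrier) :
    1 ≤ observableFunctionOfFamily (projectionFamily e) B := by
  refine le_csInf ((isBoundedSpectralFamily_projectionFamily e).nonempty_setOf_mem B)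
    fun s hs => le_of_not_gt fun hs1 => he ?_
  refine B.mem_of_le hs ?_
  unfold projectionFamily
  split_ifs <;> simp

theorem commute_of_observableFunctions_eq_neg
    (h : observableFunctions R = -observableFunctions R) :
    ∀ a ∈ R, ∀ b ∈ R, a * b = b * a := by
  refine mul_comm_of_projections_commute
    (Projection.commute_of_forall_exists_mem_iff_notMem fun e => ?_)
  have hmem : observableFunctionOfFamily (projectionFamily e) ∈ observableFunctions R :=
    ⟨_, e.compl.mem, e.compl.isStarProjection.isSelfAdjoint, _,
      isSpectralFamilyOf_projectionFamily e, rfl⟩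
  rw [h, Set.mem_neg] at hmem
  obtain ⟨A, -, -, F, hF, hfF⟩ := hmem
  have hF' := hF.toIsBoundedSpectralFamily
  -- The function of `F` is at least 0 where `e ∈ B` and at most -1 elsewhere; the level -1/2
  -- separates the two cases.
  refine ⟨F (-1 / 2), fun B => ?_⟩
  have hB : -observableFunctionOfFamily (projectionFamily e) B = observableFunctionOfFamily F B :=
    congrFun hfF B
  constructor
  · intro hq he
    have h1 : observableFunctionOfFamily F B ≤ -1 / 2 := csInf_le (hF'.bddBelow_setOf_mem B) hq
    linarith [observableFunction_projectionFamily_of_mem he]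
  · intro he
    have h1 : observableFunctionOfFamily F B < -1 / 2 := by
      linarith [observableFunction_projectionFamily_of_notMem he]
    obtain ⟨s, hs, hlt⟩ := exists_lt_of_csInf_lt (hF'.nonempty_setOf_mem B) h1
    exact B.mem_of_le hs (hF'.mono _ _ hlt.le)

end VonNeumannAlgebra

theorem mainTheorem12 {H : Type*} [NormedAddCommGroup H] [InnerProductSpace ℂ H]
    [CompleteSpace H] (R : VonNeumannAlgebra H) :
    ((∀ a ∈ R, ∀ b ∈ R, a * b = b * a) ↔
        VonNeumannAlgebra.observableFunctions R = -VonNeumannAlgebra.observableFunctions R) ∧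
      -VonNeumannAlgebra.observableFunctions R =
        VonNeumannAlgebra.mirroredObservableFunctions R :=
  ⟨⟨fun hR => (VonNeumannAlgebra.observableFunctions_eq_mirrored_of_commute hR).trans
      (VonNeumannAlgebra.neg_observableFunctions_eq R).symm,
    VonNeumannAlgebra.commute_of_observableFunctions_eq_neg⟩,
    VonNeumannAlgebra.neg_observableFunctions_eq R⟩
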